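/- For $\varepsilon>0$ and $\gamma>0$ consider the system $$-\varepsilon^2\psi_1''+x^2\psi_1+(\psi_1^2+\gamma\psi_2^2-1)\psi_1=0,\qquad -\varepsilon^2\psi_2''+x^2\psi_2+(\gamma\psi_1^2+\psi_2^2-1)\psi_2=0,\qquad x\in\mathbb R,$$ for real-valued $\Psi=(\psi_1,\psi_2)$ in the energy space $\mathcal E=H^1(\mathbb R;\mathbb R^2)\cap L^{2,1}(\mathbb R;\mathbb R^2)$, where $L^{2,1}(\mathbb R)=\{f\in L^2(\mathbb R): xf\in L^2(\mathbb R)\}$, with norm $\|\Psi\|_{\mathcal E}^2=\int_{\mathbb R}\big(|\Psi'|^2+(1+x^2)|\Psi|^2\big)\,dx$. Let $\eta_\varepsilon\in H^1(\mathbb R)\cap L^{2,1}(\mathbb R)$ be the positive solution of $\varepsilon^2\eta''+(1-x^2-\eta^2)\eta=0$ on $\mathbb R$. A domain wall is a solution $\Psi\in\mathcal E$ of the system with $\psi_1(x)=\psi_2(-x)$ for all $x$ and $\psi_1\not\equiv\psi_2$. There exists $\varepsilon_0>0$ such that for every $\varepsilon\in(0,\varepsilon_0)$ the following holds. At $\gamma=1$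 the functions $\Psi_\theta=(\cos\theta\,\eta_\varepsilon,\sin\theta\,\eta_\varepsilon)$, $\theta\in[0,\frac{\pi}{2}]$, are solutions of the system. 1. For every $\gamma>0$, $\gamma\ne1$, the uncoupled states $(\eta_\varepsilon,0)$, $(0,\eta_\varepsilon)$ and the symmetric state $(1+\gamma)^{-1/2}(\eta_\varepsilon,\eta_\varepsilon)$ are solutions, and as $\gamma\to1$ they converge in $\mathcal E$ to $\Psi_0$, $\Psi_{\pi/2}$ and $\Psi_{\pi/4}$, respectively. 2. There are no other continuations: let $\theta\in[0,\frac{\pi}{2}]$, let $A\subset(0,\infty)\setminus\{1\}$ have $1$ as an accumulation point, and let $\Psi^{(\gamma)}\in\mathcal E$, $\gamma\in A$, be solutions of the system with coupling $\gamma$ such that $\Psi^{(\gamma)}\to\Psi_\theta$ in $\mathcal E$ as $\gamma\to1$ in $A$. Then $\theta\in\{0,\frac{\pi}{4},\frac{\pi}{2}\}$, and for all $\gamma\in A$ sufficiently close to $1$, $\Psi^{(\gamma)}$ equals $(\eta_\varepsilon,0)$ if $\theta=0$, $(1+\gamma)^{-1/2}(\eta_\varepsilon,\eta_\varepsilon)$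 if $\theta=\frac{\pi}{4}$, and $(0,\eta_\varepsilon)$ if $\theta=\frac{\pi}{2}$. 3. No domain walls branch off: there are $r>0$ and $\delta_0>0$ (depending on $\varepsilon$) such that for every $\gamma>0$ with $0<|\gamma-1|<\delta_0$, every solution $\Psi\in\mathcal E$ with $\|\Psi-\Psi_\theta\|_{\mathcal E}<r$ for some $\theta\in[0,\frac{\pi}{2}]$ is one of $(\eta_\varepsilon,0)$, $(0,\eta_\varepsilon)$, $(1+\gamma)^{-1/2}(\eta_\varepsilon,\eta_\varepsilon)$; in particular it is not a domain wall. -/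

import Mathlib

open Filter Topology MeasureTheory

noncomputable section

namespace GrossPitaevskii

/-- Membership in `H¹(ℝ) ∩ L^{2,1}(ℝ)` of a function of class `C¹` (its weak derivative is then
its classical one): `f`, `f'` and `x f` are square integrable. It is only used together with an
explicit smoothness requirement. -/
def MemEnergy (f : ℝ → ℝ) : Prop :=
  MemLp f 2 volume ∧ MemLp (deriv f) 2 volume ∧ MemLp (fun x => x * f x) 2 volume

/-- The distance in the energy space `H¹(ℝ;ℝ²) ∩ L^{2,1}(ℝ;ℝ²)` between two pairs of functions of
class `C¹`; its square is the sum over both components of the integral of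
`(f')² + (1 + x²) f²`, where `f` is the difference of the components. -/
def energyDist (Ψ Φ : (ℝ → ℝ) × (ℝ → ℝ)) : ℝ :=
  √((∫ x : ℝ, (deriv (Ψ.1 - Φ.1) x ^ 2 + (1 + x ^ 2) * (Ψ.1 x - Φ.1 x) ^ 2)) +
    ∫ x : ℝ, (deriv (Ψ.2 - Φ.2) x ^ 2 + (1 + x ^ 2) * (Ψ.2 x - Φ.2 x) ^ 2))

/-- `η` is a positive solution in `H¹ ∩ L^{2,1}` of the scalar stationary Gross–Pitaevskii
equation `ε² η'' + (1 - x² - η²) η = 0` on the line. -/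
structure IsGroundState (ε : ℝ) (η : ℝ → ℝ) : Prop where
  contDiff : ContDiff ℝ 2 η
  memEnergy : MemEnergy η
  pos : ∀ x, 0 < η x
  eqn : ∀ x, ε ^ 2 * deriv (deriv η) x + (1 - x ^ 2 - η x ^ 2) * η x = 0

/-- `Ψ = (ψ₁, ψ₂)` is a real-valued solution, in the energy space, of the coupled stationary
Gross–Pitaevskii system with harmonic potential and coupling parameter `γ`. -/
structure IsSteadyState (ε γ : ℝ) (Ψ : (ℝ → ℝ) × (ℝ → ℝ)) : Prop where
  contDiff_fst : ContDiff ℝ 2 Ψ.1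
  contDiff_snd : ContDiff ℝ 2 Ψ.2
  memEnergy_fst : MemEnergy Ψ.1
  memEnergy_snd : MemEnergy Ψ.2
  eqn_fst : ∀ x, -ε ^ 2 * deriv (deriv Ψ.1) x + x ^ 2 * Ψ.1 x
    + (Ψ.1 x ^ 2 + γ * Ψ.2 x ^ 2 - 1) * Ψ.1 x = 0
  eqn_snd : ∀ x, -ε ^ 2 * deriv (deriv Ψ.2) x + x ^ 2 * Ψ.2 x
    + (γ * Ψ.1 x ^ 2 + Ψ.2 x ^ 2 - 1) * Ψ.2 x = 0

/-- The first uncoupled state `(η, 0)`. -/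
def uncoupledFst (η : ℝ → ℝ) : (ℝ → ℝ) × (ℝ → ℝ) := (η, fun _ => 0)

/-- The second uncoupled state `(0, η)`. -/
def uncoupledSnd (η : ℝ → ℝ) : (ℝ → ℝ) × (ℝ → ℝ) := (fun _ => 0, η)

/-- The symmetric state `(1 + γ)^{-1/2} (η, η)`. -/
def symmetricState (γ : ℝ) (η : ℝ → ℝ) : (ℝ → ℝ) × (ℝ → ℝ) :=
  (fun x => (√(1 + γ))⁻¹ * η x, fun x => (√(1 + γ))⁻¹ * η x)

/-- The member `(cos θ η, sin θ η)` of the one-parameter family of solutions at `γ = 1`. -/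
def rotatingState (θ : ℝ) (η : ℝ → ℝ) : (ℝ → ℝ) × (ℝ → ℝ) :=
  (fun x => Real.cos θ * η x, fun x => Real.sin θ * η x)

/-- Domain wall states: solutions with `ψ₁(x) = ψ₂(-x)` for all `x` but `ψ₁ ≢ ψ₂`. -/
def IsDomainWall (ε γ : ℝ) (Ψ : (ℝ → ℝ) × (ℝ → ℝ)) : Prop :=
  IsSteadyState ε γ Ψ ∧ (∀ x, Ψ.1 x = Ψ.2 (-x)) ∧ Ψ.1 ≠ Ψ.2

/-- The family `Ψ γ`, with `γ` in the parameter set `A`, continues the state `Ψ₀` away from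
`γ = 1`: `Ψ γ` is a solution for each `γ ∈ A`, and `Ψ γ → Ψ₀` in the energy space as
`γ → 1` within `A`. -/
def IsContinuation (ε : ℝ) (A : Set ℝ) (Ψ₀ : (ℝ → ℝ) × (ℝ → ℝ))
    (Ψ : ℝ → (ℝ → ℝ) × (ℝ → ℝ)) : Prop :=
  (∀ γ ∈ A, IsSteadyState ε γ (Ψ γ)) ∧
    Tendsto (fun γ => energyDist (Ψ γ) Ψ₀) (𝓝[A] 1) (𝓝 0)

end GrossPitaevskii

end

/-! The proof rests on the Wronskian W = U V' - V U' of two components with self-coupling a and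
cross-coupling b. The potential cancels from its derivative, W' = (b - a) ε⁻² U V (U² - V²), so
integration over the line gives ∫ U V (U² - V²) = 0 when a ≠ b. Hence 0 < V < U is impossible
(`not_pos_lt`). This excludes every angle strictly between 0 and π/4: uniform closeness to the
family yields the inequalities on [-1, 1], and outside, where x² - 1 ≥ 0, decaying solutions keep
their sign (`pos_of_forbidden`).

Near θ = 0 the same reasoning gives |V| < U and forces V to vanish somewhere. The quotient V/U has
derivative W/U², which tail integrals of W' bound by a multiple of |b - a| sup|V/U| / (1 + x²).
Integrating from a zero of V gives sup|V/U| ≤ κ sup|V/U| with κ < 1 for γ close to 1, so V = 0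
(`abs_snd_le`, `snd_eq_zero`). The first component is then η by uniqueness of the positive scalar
solution (`eq_of_pos`).

Near θ = π/4 the sum and difference of the components solve a system of the same form (`add_sub`),
so the same contraction makes the difference vanish. Exchanging the components reflects θ about π/4,
and compactness of [0, π/2] makes the neighbourhoods uniform in θ. -/

noncomputable section

namespace GrossPitaevskii

/-! ### Functions in the energy space -/

/-- The square of the energy norm of a scalar function. -/
def energySq (f : ℝ → ℝ) : ℝ := ∫ x : ℝ, (deriv f x ^ 2 + (1 + x ^ 2) * f x ^ 2)

/-- Functions of class `C²` in the energy space. -/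
structure IsRegular (f : ℝ → ℝ) : Prop where
  contDiff : ContDiff ℝ 2 f
  memEnergy : MemEnergy f

namespace IsRegular

variable {f g : ℝ → ℝ}

theorem differentiable (hf : IsRegular f) : Differentiable ℝ f :=
  hf.contDiff.differentiable two_ne_zero

theorem continuous (hf : IsRegular f) : Continuous f := hf.contDiff.continuous

theorem hasDerivAt (hf : IsRegular f) (x : ℝ) : HasDerivAt f (deriv f x) x :=
  (hf.differentiable x).hasDerivAt

theorem hasDerivAt_deriv (hf : IsRegular f) (x : ℝ) :
    HasDerivAt (deriv f) (deriv (deriv f) x) x :=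
  (hf.contDiff.differentiable_deriv_two x).hasDerivAt

theorem add (hf : IsRegular f) (hg : IsRegular g) : IsRegular (f + g) where
  contDiff := hf.contDiff.add hg.contDiff
  memEnergy := by
    refine ⟨hf.memEnergy.1.add hg.memEnergy.1, ?_, ?_⟩
    · convert hf.memEnergy.2.1.add hg.memEnergy.2.1 using 1
      ext x
      exact deriv_add (hf.differentiable x) (hg.differentiable x)
    · convert hf.memEnergy.2.2.add hg.memEnergy.2.2 using 1
      ext x
      simp [mul_add]

theorem const_mul (c : ℝ) (hf : IsRegular f) : IsRegular (fun x => c * f x) where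
  contDiff := contDiff_const.mul hf.contDiff
  memEnergy := by
    refine ⟨hf.memEnergy.1.const_mul c, ?_, ?_⟩
    · convert hf.memEnergy.2.1.const_mul c using 1
      ext x
      exact deriv_const_mul c (hf.differentiable x)
    · convert hf.memEnergy.2.2.const_mul c using 1
      ext x
      ring

theorem sub (hf : IsRegular f) (hg : IsRegular g) : IsRegular (f - g) := by
  convert hf.add (hg.const_mul (-1)) using 1
  ext x
  simp [sub_eq_add_neg]

theorem integrable_energy (hf : IsRegular f) :
    Integrable (fun x => deriv f x ^ 2 + (1 + x ^ 2) * f x ^ 2) := by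
  refine (hf.memEnergy.2.1.integrable_sq.add
    (hf.memEnergy.1.integrable_sq.add hf.memEnergy.2.2.integrable_sq)).congr
    (Eventually.of_forall fun x => ?_)
  simp only [Pi.add_apply]
  ring

theorem integrable_sq (hf : IsRegular f) : Integrable (fun x => f x ^ 2) :=
  hf.memEnergy.1.integrable_sq

theorem integrable_weight (hf : IsRegular f) : Integrable (fun x => (1 + x ^ 2) * f x ^ 2) := by
  refine (hf.memEnergy.1.integrable_sq.add hf.memEnergy.2.2.integrable_sq).congr
    (Eventually.of_forall fun x => ?_)
  simp only [Pi.add_apply]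
  ring

theorem integral_weight_le (hf : IsRegular f) :
    ∫ x, (1 + x ^ 2) * f x ^ 2 ≤ energySq f :=
  integral_mono hf.integrable_weight hf.integrable_energy fun x => by
    have := sq_nonneg (deriv f x)
    simp only
    linarith

theorem integral_sq_le (hf : IsRegular f) : ∫ x, f x ^ 2 ≤ energySq f :=
  (integral_mono hf.integrable_sq hf.integrable_weight fun x => by
    have := mul_nonneg (sq_nonneg x) (sq_nonneg (f x))
    simp only
    linarith).trans hf.integral_weight_le

theorem integrable_mul (hf : IsRegular f) (hg : IsRegular g) :
    Integrable (fun x => f x * g x) :=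
  hf.memEnergy.1.integrable_mul hg.memEnergy.1

theorem integrable_mul_deriv (hf : IsRegular f) (hg : IsRegular g) :
    Integrable (fun x => f x * deriv g x) :=
  hf.memEnergy.1.integrable_mul hg.memEnergy.2.1

theorem hasDerivAt_sq (hf : IsRegular f) (x : ℝ) :
    HasDerivAt (fun x => f x ^ 2) (2 * (f x * deriv f x)) x := by
  simpa [mul_assoc] using (hf.hasDerivAt x).fun_pow 2

theorem tendsto_atTop (hf : IsRegular f) : Tendsto f atTop (𝓝 0) := by
  have h := tendsto_zero_of_hasDerivAt_of_integrableOn_Ioi (a := 0)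
    (fun x _ => hf.hasDerivAt_sq x)
    ((hf.integrable_mul_deriv hf).const_mul 2).integrableOn hf.integrable_sq.integrableOn
  refine (tendsto_zero_iff_abs_tendsto_zero f).2 ?_
  simpa [Real.sqrt_sq_eq_abs, Function.comp_def] using h.sqrt

theorem tendsto_atBot (hf : IsRegular f) : Tendsto f atBot (𝓝 0) := by
  have h := tendsto_zero_of_hasDerivAt_of_integrableOn_Iic (a := 0)
    (fun x _ => hf.hasDerivAt_sq x)
    ((hf.integrable_mul_deriv hf).const_mul 2).integrableOn hf.integrable_sq.integrableOn
  refine (tendsto_zero_iff_abs_tendsto_zero f).2 ?_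
  simpa [Real.sqrt_sq_eq_abs, Function.comp_def] using h.sqrt

/-- Integrate (f²)' = 2 f f' ≤ f² + f'² from -∞. This Sobolev bound turns closeness in energy into
uniform closeness. -/
theorem sq_le (hf : IsRegular f) (x : ℝ) : f x ^ 2 ≤ energySq f := by
  have hint := (hf.integrable_mul_deriv hf).const_mul 2
  have h := integral_Iic_of_hasDerivAt_of_tendsto' (a := x) (fun x _ => hf.hasDerivAt_sq x)
    hint.integrableOn (by simpa using hf.tendsto_atBot.pow 2)
  rw [sub_zero] at h
  rw [← h]
  refine (setIntegral_mono hint.integrableOn hf.integrable_energy.integrableOn fun y => ?_).trans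
    (setIntegral_le_integral hf.integrable_energy (Eventually.of_forall fun y => ?_))
  · have h1 := sq_nonneg (f y - deriv f y)
    have h2 := mul_nonneg (sq_nonneg y) (sq_nonneg (f y))
    simp only
    nlinarith
  · simp only [Pi.zero_apply]
    positivity

theorem energySq_add_le (hf : IsRegular f) (hg : IsRegular g) :
    energySq (f + g) ≤ 2 * energySq f + 2 * energySq g := by
  unfold energySq
  rw [← integral_const_mul, ← integral_const_mul,
    ← integral_add (hf.integrable_energy.const_mul 2) (hg.integrable_energy.const_mul 2)]
  refine integral_mono (hf.add hg).integrable_energy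
    ((hf.integrable_energy.const_mul 2).add (hg.integrable_energy.const_mul 2)) fun x => ?_
  simp only [Pi.add_apply]
  rw [deriv_add (hf.differentiable x) (hg.differentiable x)]
  have h1 := sq_nonneg (deriv f x - deriv g x)
  have h2 := mul_nonneg (by positivity : 0 ≤ 1 + x ^ 2) (sq_nonneg (f x - g x))
  nlinarith

theorem energySq_const_mul (c : ℝ) (hf : IsRegular f) :
    energySq (fun x => c * f x) = c ^ 2 * energySq f := by
  unfold energySq
  rw [← integral_const_mul]
  congr 1
  ext x
  rw [deriv_const_mul c (hf.differentiable x)]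
  ring

theorem comp_neg (hf : IsRegular f) : IsRegular (fun x => f (-x)) where
  contDiff := hf.contDiff.comp contDiff_neg
  memEnergy := by
    have hn := Measure.measurePreserving_neg (volume : Measure ℝ)
    refine ⟨hf.memEnergy.1.comp_measurePreserving hn, ?_, ?_⟩
    · convert (hf.memEnergy.2.1.comp_measurePreserving hn).neg using 1
      ext x
      simp [deriv_comp_neg]
    · convert (hf.memEnergy.2.2.comp_measurePreserving hn).neg using 1
      ext x
      simp

end IsRegular

theorem energySq_nonneg (f : ℝ → ℝ) : 0 ≤ energySq f :=
  integral_nonneg fun x => by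
    simp only [Pi.zero_apply]
    positivity

/-! ### Positivity and monotonicity in the classically forbidden region -/

/-- Backward Grönwall argument: with K ≥ |q| on [a, b], the weight exp((1 + K)x) makes (y² + y'²)
exp((1 + K)x) nondecreasing there, so its vanishing at b carries over to a. -/
theorem eq_zero_of_linear_ode {y q : ℝ → ℝ} (hy : ContDiff ℝ 2 y) (hq : Continuous q)
    (hode : ∀ x, deriv (deriv y) x = q x * y x) {a b : ℝ} (hab : a ≤ b)
    (hb : y b = 0) (hb' : deriv y b = 0) : y a = 0 := by
  obtain ⟨K, hK⟩ := (isCompact_Icc (a := a) (b := b)).exists_bound_of_continuousOn hq.continuousOn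
  set E : ℝ → ℝ := fun x => (y x ^ 2 + deriv y x ^ 2) * Real.exp ((1 + K) * x) with hE
  have hd : ∀ x, HasDerivAt E ((2 * y x * deriv y x + 2 * deriv y x * (q x * y x)) *
      Real.exp ((1 + K) * x) + (y x ^ 2 + deriv y x ^ 2) *
        (Real.exp ((1 + K) * x) * (1 + K))) x := by
    intro x
    have h1 := (hy.differentiable two_ne_zero x).hasDerivAt
    have h2 := (hy.differentiable_deriv_two x).hasDerivAt
    rw [hode] at h2
    have h3 : HasDerivAt (fun x : ℝ => Real.exp ((1 + K) * x))
        (Real.exp ((1 + K) * x) * (1 + K)) x := by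
      simpa using ((hasDerivAt_id x).const_mul (1 + K)).exp
    simpa only [Nat.cast_ofNat, Nat.add_one_sub_one, pow_one] using
      ((h1.fun_pow 2).fun_add (h2.fun_pow 2)).fun_mul h3
  have hmono : MonotoneOn E (Set.Icc a b) := by
    refine monotoneOn_of_deriv_nonneg (convex_Icc a b)
      (fun x _ => (hd x).continuousAt.continuousWithinAt)
      (fun x _ => (hd x).differentiableAt.differentiableWithinAt) fun x hx => ?_
    rw [interior_Icc] at hx
    rw [(hd x).deriv]
    have hKx := hK x (Set.Ioo_subset_Icc_self hx)
    rw [Real.norm_eq_abs, abs_le] at hKx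
    have : 0 ≤ 2 * y x * deriv y x + 2 * deriv y x * (q x * y x) +
        (y x ^ 2 + deriv y x ^ 2) * (1 + K) := by
      nlinarith [sq_nonneg (y x + deriv y x), sq_nonneg (y x - deriv y x),
        mul_nonneg (sub_nonneg.2 hKx.1) (sq_nonneg (y x + deriv y x)),
        mul_nonneg (sub_nonneg.2 hKx.2) (sq_nonneg (y x - deriv y x))]
    calc 0 ≤ _ := mul_nonneg this (Real.exp_pos ((1 + K) * x)).le
      _ = _ := by ring
  have h := hmono (Set.left_mem_Icc.2 hab) (Set.right_mem_Icc.2 hab) hab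
  simp only [hE, hb, hb'] at h
  have : y a ^ 2 + deriv y a ^ 2 ≤ 0 := by
    by_contra! hc
    have := mul_pos hc (Real.exp_pos ((1 + K) * a))
    norm_num at h
    linarith
  have h2 : y a ^ 2 = 0 := le_antisymm (by nlinarith [sq_nonneg (deriv y a)]) (sq_nonneg _)
  exact pow_eq_zero_iff two_ne_zero |>.1 h2

/-- Since (y y')' = y'² + q y² ≥ 0, a positive value of y y' would make y² nondecreasing from there
on, against decay. So y² is nonincreasing; a zero would make y vanish on a half-line, and ODE
uniqueness would carry this back to a. -/
theorem pos_and_antitoneOn_of_forbidden {y q : ℝ → ℝ} (hy : ContDiff ℝ 2 y) (hq : Continuous q)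
    (hode : ∀ x, deriv (deriv y) x = q x * y x) {a : ℝ} (hq0 : ∀ x, a ≤ x → 0 ≤ q x)
    (ha : 0 < y a) (hlim : Tendsto y atTop (𝓝 0)) :
    (∀ x, a ≤ x → 0 < y x) ∧ AntitoneOn y (Set.Ici a) := by
  have h1 := fun x => (hy.differentiable two_ne_zero x).hasDerivAt
  have h2 := fun x => (hy.differentiable_deriv_two x).hasDerivAt
  have hsq : ∀ x, HasDerivAt (fun x => y x ^ 2) (2 * (y x * deriv y x)) x := fun x => by
    simpa [mul_assoc] using (h1 x).fun_pow 2
  have hmono : MonotoneOn (fun x => y x * deriv y x) (Set.Ici a) := by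
    have hd := fun x => (h1 x).mul (h2 x)
    refine monotoneOn_of_deriv_nonneg (convex_Ici a)
      (fun x _ => (hd x).continuousAt.continuousWithinAt)
      (fun x _ => (hd x).differentiableAt.differentiableWithinAt) fun x hx => ?_
    rw [interior_Ici] at hx
    have := mul_nonneg (hq0 x hx.le) (sq_nonneg (y x))
    change 0 ≤ deriv (y * deriv y) x
    rw [(hd x).deriv, hode]
    nlinarith [sq_nonneg (deriv y x)]
  have hneg : ∀ x, a ≤ x → y x * deriv y x ≤ 0 := by
    intro x hx
    by_contra! hpos
    have hm : MonotoneOn (fun x => y x ^ 2) (Set.Ici x) := by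
      refine monotoneOn_of_deriv_nonneg (convex_Ici x)
        (fun z _ => (hsq z).continuousAt.continuousWithinAt)
        (fun z _ => (hsq z).differentiableAt.differentiableWithinAt) fun z hz => ?_
      rw [interior_Ici] at hz
      rw [(hsq z).deriv]
      have := hmono (Set.mem_Ici.2 hx) (Set.mem_Ici.2 (hx.trans hz.le)) hz.le
      simp only at this
      linarith
    have hl : Tendsto (fun x => y x ^ 2) atTop (𝓝 0) := by simpa using hlim.pow 2
    have hle : y x ^ 2 ≤ 0 := ge_of_tendsto hl <| (eventually_ge_atTop x).mono fun z hz =>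
      hm (Set.mem_Ici.2 le_rfl) hz hz
    have : y x = 0 := pow_eq_zero_iff two_ne_zero |>.1 (le_antisymm hle (sq_nonneg _))
    simp [this] at hpos
  have hanti : AntitoneOn (fun x => y x ^ 2) (Set.Ici a) := by
    refine antitoneOn_of_deriv_nonpos (convex_Ici a)
      (fun z _ => (hsq z).continuousAt.continuousWithinAt)
      (fun z _ => (hsq z).differentiableAt.differentiableWithinAt) fun z hz => ?_
    rw [interior_Ici] at hz
    rw [(hsq z).deriv]
    have := hneg z hz.le
    linarith
  have hne : ∀ x, a ≤ x → y x ≠ 0 := by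
    intro x hx h0
    have hz : ∀ z, x ≤ z → y z = 0 := fun z hz => by
      have := hanti (Set.mem_Ici.2 hx) (Set.mem_Ici.2 (hx.trans hz)) hz
      simp only [h0] at this
      exact pow_eq_zero_iff two_ne_zero |>.1 (le_antisymm (by simpa using this) (sq_nonneg _))
    have hev : y =ᶠ[𝓝 (x + 1)] fun _ => 0 :=
      (eventually_ge_nhds (lt_add_one x)).mono fun z h => hz z h
    have hd : deriv y (x + 1) = 0 := by rw [hev.deriv_eq]; simp
    exact ha.ne' (eq_zero_of_linear_ode hy hq hode (by linarith) (hz (x + 1) (by linarith)) hd)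
  have hpos : ∀ x, a ≤ x → 0 < y x := by
    intro x hx
    by_contra! hle
    obtain ⟨z, hz, hz0⟩ := intermediate_value_Icc' hx hy.continuous.continuousOn
      (Set.mem_Icc.2 ⟨hle, ha.le⟩)
    exact hne z hz.1 hz0
  refine ⟨hpos, fun x hx z hz hxz => ?_⟩
  have := hanti hx hz hxz
  exact (sq_le_sq₀ (hpos z hz).le (hpos x hx).le).1 this

theorem IsRegular.pos_of_forbidden {y q : ℝ → ℝ} (hy : IsRegular y) (hq : Continuous q)
    (hode : ∀ x, deriv (deriv y) x = q x * y x) (hq0 : ∀ x, 1 ≤ |x| → 0 ≤ q x)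
    (hpos : ∀ x ∈ Set.Icc (-1 : ℝ) 1, 0 < y x) :
    (∀ x, 0 < y x) ∧ AntitoneOn y (Set.Ici 1) ∧ MonotoneOn y (Set.Iic (-1)) := by
  obtain ⟨hr, hr'⟩ := pos_and_antitoneOn_of_forbidden hy.contDiff hq hode (a := 1)
    (fun x hx => hq0 x (hx.trans (le_abs_self x))) (hpos 1 (by simp)) hy.tendsto_atTop
  have hy' := hy.comp_neg
  obtain ⟨hl, hl'⟩ := pos_and_antitoneOn_of_forbidden hy'.contDiff (hq.comp continuous_neg)
    (y := fun x => y (-x)) (q := fun x => q (-x)) (a := 1) (fun x => by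
      have : deriv (fun x => y (-x)) = fun x => -deriv y (-x) := by
        ext x; exact deriv_comp_neg y x
      rw [this, deriv.fun_neg, deriv_comp_neg, neg_neg, hode])
    (fun x hx => hq0 (-x) (by rw [abs_neg]; exact hx.trans (le_abs_self x)))
    (hpos (-1) (by simp)) hy'.tendsto_atTop
  refine ⟨fun x => ?_, hr', fun x hx z hz hxz => ?_⟩
  · rcases le_total 1 x with h | h
    · exact hr x h
    rcases le_total x (-1) with h' | h'
    · simpa using hl (-x) (by linarith)
    · exact hpos x ⟨h', h⟩
  · have hx' : x ≤ -1 := hx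
    have hz' : z ≤ -1 := hz
    simpa using hl' (a := -z) (b := -x) (Set.mem_Ici.2 (by linarith)) (Set.mem_Ici.2 (by linarith))
      (by linarith)

/-! ### Functions with small derivative -/

/-- Both c arctan ± f are monotone, and arctan has total variation π. -/
theorem abs_sub_le_of_abs_deriv_le {f f' : ℝ → ℝ} {c : ℝ} (hf : ∀ x, HasDerivAt f (f' x) x)
    (hf' : ∀ x, |f' x| ≤ c / (1 + x ^ 2)) (x y : ℝ) : |f x - f y| ≤ c * Real.pi := by
  have hc : 0 ≤ c := by simpa using (abs_nonneg _).trans (hf' 0)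
  have harc : ∀ x, HasDerivAt (fun x => c * Real.arctan x) (c / (1 + x ^ 2)) x := fun x => by
    simpa [div_eq_mul_inv] using (Real.hasDerivAt_arctan x).const_mul c
  have h1 : Monotone fun x => c * Real.arctan x - f x := by
    refine monotone_of_deriv_nonneg
      (fun x => ((harc x).fun_sub (hf x)).differentiableAt) fun x => ?_
    rw [((harc x).fun_sub (hf x)).deriv]
    linarith [(abs_le.1 (hf' x)).2]
  have h2 : Monotone fun x => c * Real.arctan x + f x := by
    refine monotone_of_deriv_nonneg
      (fun x => ((harc x).fun_add (hf x)).differentiableAt) fun x => ?_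
    rw [((harc x).fun_add (hf x)).deriv]
    linarith [(abs_le.1 (hf' x)).1]
  have hb : ∀ x y, c * Real.arctan x - c * Real.arctan y ≤ c * Real.pi := fun x y => by
    rw [← mul_sub]
    exact mul_le_mul_of_nonneg_left
      (by linarith [Real.arctan_lt_pi_div_two x, Real.neg_pi_div_two_lt_arctan y]) hc
  rw [abs_le]
  rcases le_total x y with h | h
  · have := h1 h; have := h2 h; have := hb y x
    constructor <;> simp only at * <;> linarith
  · have := h1 h; have := h2 h; have := hb x y
    constructor <;> simp only at * <;> linarith

theorem abs_le_integral_Ioi {W F : ℝ → ℝ} (hd : ∀ x, HasDerivAt W (F x) x) (hW : Integrable W)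
    (hF : Integrable F) (x : ℝ) : |W x| ≤ ∫ y in Set.Ioi x, |F y| := by
  have ht := tendsto_zero_of_hasDerivAt_of_integrableOn_Ioi (a := x) (fun x _ => hd x)
    hF.integrableOn hW.integrableOn
  have h := integral_Ioi_of_hasDerivAt_of_tendsto' (a := x) (fun x _ => hd x) hF.integrableOn ht
  rw [zero_sub] at h
  rw [← abs_neg, ← h]
  exact abs_integral_le_integral_abs

theorem abs_le_integral_Iic {W F : ℝ → ℝ} (hd : ∀ x, HasDerivAt W (F x) x) (hW : Integrable W)
    (hF : Integrable F) (x : ℝ) : |W x| ≤ ∫ y in Set.Iic x, |F y| := by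
  have ht := tendsto_zero_of_hasDerivAt_of_integrableOn_Iic (a := x) (fun x _ => hd x)
    hF.integrableOn hW.integrableOn
  have h := integral_Iic_of_hasDerivAt_of_tendsto' (a := x) (fun x _ => hd x) hF.integrableOn ht
  rw [sub_zero] at h
  rw [← h]
  exact abs_integral_le_integral_abs

/-! ### Symmetrically coupled systems -/

/-- Solutions of a symmetric system with self-interaction `a` and cross-interaction `b`. The steady
states are the case `a = 1`, but their sums and differences solve such a system, too. -/
structure CoupledSolution (ε a b : ℝ) (U V : ℝ → ℝ) : Prop where
  fst : IsRegular U
  snd : IsRegular V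
  eqn_fst : ∀ x, ε ^ 2 * deriv (deriv U) x = (x ^ 2 - 1 + a * U x ^ 2 + b * V x ^ 2) * U x
  eqn_snd : ∀ x, ε ^ 2 * deriv (deriv V) x = (x ^ 2 - 1 + b * U x ^ 2 + a * V x ^ 2) * V x

namespace CoupledSolution

variable {ε a b : ℝ} {U V : ℝ → ℝ}

theorem swap (h : CoupledSolution ε a b U V) : CoupledSolution ε a b V U where
  fst := h.snd
  snd := h.fst
  eqn_fst x := by rw [h.eqn_snd]; ring
  eqn_snd x := by rw [h.eqn_fst]; ring

/-- This sign symmetry turns results on U + V or on positive V into results on U - V or on negative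
V. -/
theorem neg_snd (h : CoupledSolution ε a b U V) :
    CoupledSolution ε a b U (fun x => -1 * V x) where
  fst := h.fst
  snd := h.snd.const_mul (-1)
  eqn_fst x := by rw [h.eqn_fst]; ring
  eqn_snd x := by
    have : deriv (fun x => -1 * V x) = fun x => -1 * deriv V x := by
      ext x; exact deriv_const_mul _ (h.snd.differentiable x)
    rw [this, deriv_const_mul _ (h.snd.contDiff.differentiable_deriv_two x)]
    linear_combination (-1 : ℝ) * h.eqn_snd x

theorem deriv_deriv_add (h : CoupledSolution ε a b U V) (x : ℝ) :
    ε ^ 2 * deriv (deriv (U + V)) x =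
      (x ^ 2 - 1 + a * U x ^ 2 + a * V x ^ 2 + (b - a) * (U x * V x)) * (U + V) x := by
  have : deriv (U + V) = deriv U + deriv V := by
    ext x; exact deriv_add (h.fst.differentiable x) (h.snd.differentiable x)
  rw [this, deriv_add (h.fst.contDiff.differentiable_deriv_two x)
    (h.snd.contDiff.differentiable_deriv_two x)]
  simp only [Pi.add_apply]
  linear_combination h.eqn_fst x + h.eqn_snd x

theorem pos_fst (h : CoupledSolution ε a b U V) (hε : 0 < ε) (ha : 0 ≤ a) (hb : 0 ≤ b)
    (hU : ∀ x ∈ Set.Icc (-1 : ℝ) 1, 0 < U x) :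
    (∀ x, 0 < U x) ∧ AntitoneOn U (Set.Ici 1) ∧ MonotoneOn U (Set.Iic (-1)) := by
  have := h.fst.continuous
  have := h.snd.continuous
  refine h.fst.pos_of_forbidden
    (q := fun x => (x ^ 2 - 1 + a * U x ^ 2 + b * V x ^ 2) / ε ^ 2) (by fun_prop) (fun x => ?_)
    (fun x hx => ?_) hU
  · have := h.eqn_fst x
    field_simp
    linarith
  · have : 1 ≤ x ^ 2 := by rw [← sq_abs]; exact one_le_pow₀ hx
    have := mul_nonneg ha (sq_nonneg (U x))
    have := mul_nonneg hb (sq_nonneg (V x))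
    exact div_nonneg (by linarith) (sq_nonneg _)

/-- The sum solves a linear equation whose coefficient contains the quadratic form a(U² + V²) + (b -
a)UV; the condition |b - a| ≤ 2a makes that form nonnegative. -/
theorem pos_add (h : CoupledSolution ε a b U V) (hε : 0 < ε) (hab : |b - a| ≤ 2 * a)
    (hU : ∀ x ∈ Set.Icc (-1 : ℝ) 1, 0 < U x + V x) (x : ℝ) : 0 < U x + V x := by
  have := h.fst.continuous
  have := h.snd.continuous
  refine ((h.fst.add h.snd).pos_of_forbidden
    (q := fun x => (x ^ 2 - 1 + a * U x ^ 2 + a * V x ^ 2 + (b - a) * (U x * V x)) / ε ^ 2)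
    (by fun_prop) (fun x => ?_) (fun x hx => ?_) hU).1 x
  · have := h.deriv_deriv_add x
    field_simp
    linarith
  · have : 1 ≤ x ^ 2 := by rw [← sq_abs]; exact one_le_pow₀ hx
    obtain ⟨h1, h2⟩ := abs_le.1 hab
    refine div_nonneg ?_ (sq_nonneg _)
    nlinarith [mul_nonneg (by linarith : 0 ≤ 2 * a + (b - a)) (sq_nonneg (U x + V x)),
      mul_nonneg (by linarith : 0 ≤ 2 * a - (b - a)) (sq_nonneg (U x - V x))]

theorem pos_sub (h : CoupledSolution ε a b U V) (hε : 0 < ε) (hab : |b - a| ≤ 2 * a)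
    (hU : ∀ x ∈ Set.Icc (-1 : ℝ) 1, 0 < U x - V x) (x : ℝ) : 0 < U x - V x := by
  have := h.neg_snd.pos_add hε hab (fun x hx => by have := hU x hx; linarith) x
  linarith

/-- The Wronskian of the two components. -/
def wronskian (U V : ℝ → ℝ) (x : ℝ) : ℝ := U x * deriv V x - V x * deriv U x

theorem hasDerivAt_wronskian (h : CoupledSolution ε a b U V) (hε : 0 < ε) (x : ℝ) :
    HasDerivAt (wronskian U V)
      ((b - a) / ε ^ 2 * (U x * V x * (U x ^ 2 - V x ^ 2))) x := by
  refine (((h.fst.hasDerivAt x).fun_mul (h.snd.hasDerivAt_deriv x)).fun_sub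
    ((h.snd.hasDerivAt x).fun_mul (h.fst.hasDerivAt_deriv x))).congr_deriv ?_
  field_simp
  linear_combination U x * h.eqn_snd x - V x * h.eqn_fst x

theorem integrable_wronskian (h : CoupledSolution ε a b U V) : Integrable (wronskian U V) :=
  (h.fst.integrable_mul_deriv h.snd).sub (h.snd.integrable_mul_deriv h.fst)

end CoupledSolution

theorem IsRegular.abs_le {f : ℝ → ℝ} (hf : IsRegular f) (x : ℝ) : |f x| ≤ √(energySq f) :=
  Real.abs_le_sqrt (hf.sq_le x)

theorem IsRegular.integrable_mul_mul {f g k : ℝ → ℝ} (hf : IsRegular f) (hg : IsRegular g)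
    (hk : IsRegular k) : Integrable (fun x => f x * g x * k x) :=
  (hf.integrable_mul hg).mul_bdd (c := √(energySq k)) hk.continuous.aestronglyMeasurable
    (Eventually.of_forall hk.abs_le)

theorem IsRegular.integrable_mul_mul_mul {f g k l : ℝ → ℝ} (hf : IsRegular f) (hg : IsRegular g)
    (hk : IsRegular k) (hl : IsRegular l) : Integrable (fun x => f x * g x * k x * l x) :=
  (hf.integrable_mul_mul hg hk).mul_bdd (c := √(energySq l)) hl.continuous.aestronglyMeasurable
    (Eventually.of_forall hl.abs_le)

/-! ### Consequences of the Wronskian identity -/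

namespace CoupledSolution

variable {ε a b : ℝ} {U V : ℝ → ℝ}

theorem integrable_interaction (h : CoupledSolution ε a b U V) :
    Integrable (fun x => U x * V x * (U x ^ 2 - V x ^ 2)) :=
  ((h.fst.integrable_mul_mul_mul h.snd h.fst h.fst).sub
    (h.fst.integrable_mul_mul_mul h.snd h.snd h.snd)).congr
    (Eventually.of_forall fun x => by simp only [Pi.sub_apply]; ring)

theorem integral_interaction (h : CoupledSolution ε a b U V) (hε : 0 < ε) (hab : a ≠ b) :
    ∫ x, U x * V x * (U x ^ 2 - V x ^ 2) = 0 := by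
  have := integral_eq_zero_of_hasDerivAt_of_integrable (h.hasDerivAt_wronskian hε)
    (h.integrable_interaction.const_mul _) h.integrable_wronskian
  rw [integral_const_mul, mul_eq_zero] at this
  refine this.resolve_left (div_ne_zero (sub_ne_zero.2 hab.symm) (by positivity))

theorem not_pos_lt (h : CoupledSolution ε a b U V) (hε : 0 < ε) (hab : a ≠ b)
    (hV : ∀ x, 0 < V x) (hVU : ∀ x, V x < U x) : False := by
  have hU := h.fst.continuous
  have hV' := h.snd.continuous
  have hpos : ∀ x, 0 < U x * V x * (U x ^ 2 - V x ^ 2) := fun x => by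
    have h1 := hV x
    have h2 := hVU x
    have : 0 < U x := h1.trans h2
    have : 0 < U x ^ 2 - V x ^ 2 := by nlinarith
    positivity
  exact (integral_pos_of_integrable_nonneg_nonzero (x := 0) (by fun_prop) h.integrable_interaction
    (fun x => (hpos x).le) (hpos 0).ne').ne' (h.integral_interaction hε hab)

/-- One step of the contraction argument for the quotient of the components. -/
theorem abs_snd_le (h : CoupledSolution ε a b U V) (hε : 0 < ε) (hab : a ≠ b)
    (hU : ∀ x, 0 < U x) (hanti : AntitoneOn U (Set.Ici 1)) (hmono : MonotoneOn U (Set.Iic (-1)))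
    (hVU : ∀ x, |V x| < U x) {m N : ℝ} (hm : 0 < m) (hmU : ∀ x ∈ Set.Icc (-1 : ℝ) 1, m ≤ U x)
    (hN : energySq U ≤ N) {M : ℝ} (hM0 : 0 ≤ M) (hM : ∀ x, |V x| ≤ M * U x) (x : ℝ) :
    |V x| ≤ |b - a| / ε ^ 2 * (N + 2 * N ^ 2 / m ^ 2) * Real.pi * M * U x := by
  have hN0 : 0 ≤ N := (energySq_nonneg U).trans hN
  set F : ℝ → ℝ := fun x => (b - a) / ε ^ 2 * (U x * V x * (U x ^ 2 - V x ^ 2)) with hFdef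
  have hF : Integrable F := h.integrable_interaction.const_mul _
  set k : ℝ := |b - a| / ε ^ 2 * M with hk
  have hk0 : 0 ≤ k := by positivity
  -- One factor V is estimated by M U, which makes the final bound linear in M; |V| < U handles the
  -- other occurrences.
  have hFle : ∀ y, |F y| ≤ k * (U y ^ 2 * U y ^ 2) := fun y => by
    have hsq : V y ^ 2 ≤ U y ^ 2 := sq_le_sq' (by linarith [(abs_lt.1 (hVU y)).1])
      (abs_lt.1 (hVU y)).2.le
    have h1 : |U y ^ 2 - V y ^ 2| ≤ U y ^ 2 := by
      rw [abs_le]; constructor <;> nlinarith [sq_nonneg (V y)]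
    have hUy := (hU y).le
    simp only [hFdef, abs_mul, abs_div, abs_pow, abs_of_pos hε, abs_of_pos (hU y)]
    calc |b - a| / ε ^ 2 * (U y * |V y| * |U y ^ 2 - V y ^ 2|)
        ≤ |b - a| / ε ^ 2 * (U y * (M * U y) * U y ^ 2) := by gcongr; exact hM y
      _ = k * (U y ^ 2 * U y ^ 2) := by rw [hk]; ring
  have hU4 : Integrable fun y => U y ^ 2 * U y ^ 2 :=
    (h.fst.integrable_mul_mul_mul h.fst h.fst h.fst).congr
      (Eventually.of_forall fun x => by simp only; ring)
  -- the part of the mass on one side of a point in the forbidden region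
  have htail : ∀ (x : ℝ) (S : Set ℝ), MeasurableSet S → (∀ y ∈ S, U y ≤ U x ∧ x ^ 2 ≤ y ^ 2) →
      ∫ y in S, |F y| ≤ k * (U x ^ 2 * (N / (1 + x ^ 2))) := by
    intro x S hS hSx
    have hx : 0 < 1 + x ^ 2 := by positivity
    calc ∫ y in S, |F y|
        ≤ ∫ y in S, k * (U x ^ 2 / (1 + x ^ 2)) * ((1 + y ^ 2) * U y ^ 2) := by
          refine setIntegral_mono_on hF.abs.integrableOn
            (h.fst.integrable_weight.const_mul _).integrableOn hS fun y hy => ?_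
          obtain ⟨h1, h2⟩ := hSx y hy
          have hUy := (hU y).le
          refine (hFle y).trans ?_
          rw [mul_assoc k]
          refine mul_le_mul_of_nonneg_left ?_ hk0
          have h3 : U y ^ 2 ≤ U x ^ 2 := by gcongr
          have h4 : 1 ≤ (1 + y ^ 2) / (1 + x ^ 2) := by rw [one_le_div hx]; linarith
          calc U y ^ 2 * U y ^ 2 ≤ U x ^ 2 * U y ^ 2 * 1 := by rw [mul_one]; gcongr
            _ ≤ U x ^ 2 * U y ^ 2 * ((1 + y ^ 2) / (1 + x ^ 2)) := by gcongr
            _ = _ := by ring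
      _ ≤ ∫ y, k * (U x ^ 2 / (1 + x ^ 2)) * ((1 + y ^ 2) * U y ^ 2) :=
          setIntegral_le_integral (h.fst.integrable_weight.const_mul _)
            (Eventually.of_forall fun y => by simp only [Pi.zero_apply]; positivity)
      _ ≤ k * (U x ^ 2 / (1 + x ^ 2)) * N := by
          rw [integral_const_mul]
          exact mul_le_mul_of_nonneg_left (h.fst.integral_weight_le.trans hN) (by positivity)
      _ = _ := by ring
  -- A cruder bound for x in [-1, 1], where U need not be monotone.
  have hmain : ∀ x, ∫ y in Set.Ioi x, |F y| ≤ k * N ^ 2 := by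
    intro x
    calc ∫ y in Set.Ioi x, |F y| ≤ ∫ y, |F y| :=
          setIntegral_le_integral hF.abs (Eventually.of_forall fun y => abs_nonneg _)
      _ ≤ ∫ y, k * N * U y ^ 2 := by
          refine integral_mono hF.abs (h.fst.integrable_sq.const_mul _) fun y => ?_
          refine (hFle y).trans ?_
          rw [mul_assoc k]
          refine mul_le_mul_of_nonneg_left ?_ hk0
          have := (h.fst.sq_le y).trans hN
          gcongr
      _ ≤ k * N * N := by
          rw [integral_const_mul]
          exact mul_le_mul_of_nonneg_left (h.fst.integral_sq_le.trans hN) (by positivity)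
      _ = _ := by ring
  have hderiv : ∀ x, HasDerivAt (fun x => V x / U x) (wronskian U V x / U x ^ 2) x := fun x => by
    refine ((h.snd.hasDerivAt x).fun_div (h.fst.hasDerivAt x) (hU x).ne').congr_deriv ?_
    unfold wronskian
    ring
  -- The term N comes from the tails beyond ±1, where the factor U(x)² cancels. The term 2N²/m²
  -- covers [-1, 1], where U ≥ m and 1 + x² ≤ 2.
  have hbound : ∀ x, |wronskian U V x / U x ^ 2| ≤
      k * (N + 2 * N ^ 2 / m ^ 2) / (1 + x ^ 2) := by
    intro x
    have hUx := hU x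
    have hx : 0 < 1 + x ^ 2 := by positivity
    rw [abs_div, abs_of_pos (pow_pos hUx 2), div_le_iff₀ (pow_pos hUx 2)]
    have hR := abs_le_integral_Ioi (h.hasDerivAt_wronskian hε) h.integrable_wronskian hF x
    have hL := abs_le_integral_Iic (h.hasDerivAt_wronskian hε) h.integrable_wronskian hF x
    have hout : k * (U x ^ 2 * (N / (1 + x ^ 2))) ≤
        k * (N + 2 * N ^ 2 / m ^ 2) / (1 + x ^ 2) * U x ^ 2 := by
      calc k * (U x ^ 2 * (N / (1 + x ^ 2))) = k * (N + 0) / (1 + x ^ 2) * U x ^ 2 := by ring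
        _ ≤ _ := by gcongr; positivity
    rcases le_total 1 x with h1 | h1
    · refine (hR.trans (htail x _ measurableSet_Ioi fun y hy => ?_)).trans hout
      have hy' : x < y := hy
      exact ⟨hanti (Set.mem_Ici.2 h1) (Set.mem_Ici.2 (h1.trans hy'.le)) hy'.le, by nlinarith⟩
    rcases le_total x (-1) with h2 | h2
    · refine (hL.trans (htail x _ measurableSet_Iic fun y hy => ?_)).trans hout
      have hy' : y ≤ x := hy
      exact ⟨hmono (Set.mem_Iic.2 (hy'.trans h2)) (Set.mem_Iic.2 h2) hy', by nlinarith⟩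
    · refine (hR.trans (hmain x)).trans ?_
      have hx2 : x ^ 2 ≤ 1 := by nlinarith
      have hmx := hmU x ⟨h2, h1⟩
      calc k * N ^ 2 = k * (0 + 2 * N ^ 2 / m ^ 2) / (1 + 1) * m ^ 2 := by field_simp; ring
        _ ≤ _ := by gcongr
  -- the second component has a zero
  obtain ⟨z, hz⟩ : ∃ z, V z = 0 := by
    by_contra! hne
    have hc := h.snd.continuous
    rcases lt_or_gt_of_ne (hne 0) with h0 | h0
    · have hneg : ∀ x, V x < 0 := fun x => by
        by_contra! hx
        obtain ⟨z, hz⟩ := mem_range_of_exists_le_of_exists_ge hc ⟨0, h0.le⟩ ⟨x, hx⟩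
        exact hne z hz
      exact h.neg_snd.not_pos_lt hε hab (fun x => by linarith [hneg x])
        fun x => by linarith [(abs_lt.1 (hVU x)).1]
    · have hpos : ∀ x, 0 < V x := fun x => by
        by_contra! hx
        obtain ⟨z, hz⟩ := mem_range_of_exists_le_of_exists_ge hc ⟨x, hx⟩ ⟨0, h0.le⟩
        exact hne z hz
      exact h.not_pos_lt hε hab hpos fun x => (abs_lt.1 (hVU x)).2
  have := abs_sub_le_of_abs_deriv_le hderiv hbound x z
  rw [hz, zero_div, sub_zero, abs_div, abs_of_pos (hU x), div_le_iff₀ (hU x)] at this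
  refine this.trans_eq ?_
  rw [hk]
  ring

/-- Starting from |V| < U, repeated use of `abs_snd_le` gives |V| ≤ κⁿ U for every n, with κ < 1. -/
theorem snd_eq_zero (h : CoupledSolution ε a b U V) (hε : 0 < ε) (hab : a ≠ b)
    (ha : 0 ≤ a) (hb : 0 ≤ b) (hba : |b - a| ≤ 2 * a) {m N : ℝ} (hm : 0 < m)
    (hmU : ∀ x ∈ Set.Icc (-1 : ℝ) 1, m ≤ U x) (hVU : ∀ x ∈ Set.Icc (-1 : ℝ) 1, |V x| < U x)
    (hN : energySq U ≤ N) (hsmall : |b - a| / ε ^ 2 * (N + 2 * N ^ 2 / m ^ 2) * Real.pi < 1)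
    (x : ℝ) : V x = 0 := by
  obtain ⟨hU, hanti, hmono⟩ := h.pos_fst hε ha hb fun x hx => hm.trans_le (hmU x hx)
  have hVU' : ∀ x, |V x| < U x := fun x => by
    have h1 := h.pos_add hε hba (fun x hx => by linarith [(abs_lt.1 (hVU x hx)).1]) x
    have h2 := h.pos_sub hε hba (fun x hx => by linarith [(abs_lt.1 (hVU x hx)).2]) x
    rw [abs_lt]
    constructor <;> linarith
  have hN0 : 0 ≤ N := (energySq_nonneg U).trans hN
  set κ := |b - a| / ε ^ 2 * (N + 2 * N ^ 2 / m ^ 2) * Real.pi with hκ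
  have hκ0 : 0 ≤ κ := by have := Real.pi_pos; positivity
  have hiter : ∀ n : ℕ, ∀ x, |V x| ≤ κ ^ n * U x := by
    intro n
    induction n with
    | zero => intro x; simpa using (hVU' x).le
    | succ n ih =>
      intro x
      have := h.abs_snd_le hε hab hU hanti hmono hVU' hm hmU hN (by positivity) ih x
      rwa [← hκ, ← pow_succ'] at this
  have hlim : Tendsto (fun n : ℕ => κ ^ n * U x) atTop (𝓝 0) := by
    simpa using (tendsto_pow_atTop_nhds_zero_of_lt_one hκ0 hsmall).mul_const (U x)
  exact abs_nonpos_iff.1 (ge_of_tendsto' hlim fun n => hiter n x)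

/-- Uniqueness of positive solutions of the scalar equation. -/
theorem eq_of_pos (h : CoupledSolution ε 1 0 U V) (hε : 0 < ε) (hU : ∀ x, 0 < U x)
    (hV : ∀ x, 0 < V x) : U = V := by
  obtain ⟨-, hanti, hmono⟩ := h.pos_fst hε zero_le_one le_rfl fun x _ => hU x
  set F : ℝ → ℝ := fun x => (0 - 1) / ε ^ 2 * (U x * V x * (U x ^ 2 - V x ^ 2)) with hFdef
  have hF : Integrable F := h.integrable_interaction.const_mul _
  -- Here W' = F = -U H, so where U decreases outwards, W is at most U times the integral of |H|,
  -- and W/U stays bounded.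
  set H : ℝ → ℝ := fun x => V x * (U x ^ 2 - V x ^ 2) / ε ^ 2 with hHdef
  have hH : Integrable H :=
    (((h.snd.integrable_mul_mul h.fst h.fst).sub
      (h.snd.integrable_mul_mul h.snd h.snd)).div_const (ε ^ 2)).congr
      (Eventually.of_forall fun x => by simp only [Pi.sub_apply, hHdef]; ring)
  have htail : ∀ (x : ℝ) (S : Set ℝ), MeasurableSet S → (∀ y ∈ S, U y ≤ U x) →
      ∫ y in S, |F y| ≤ U x * ∫ y, |H y| := by
    intro x S hS hSx
    have hUx := (hU x).le
    rw [← integral_const_mul]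
    refine (setIntegral_mono_on hF.abs.integrableOn (hH.abs.const_mul (U x)).integrableOn hS
      fun y hy => ?_).trans (setIntegral_le_integral (hH.abs.const_mul (U x))
        (Eventually.of_forall fun y => by simp only [Pi.zero_apply]; positivity))
    have : F y = -(U y * H y) := by simp only [hFdef, hHdef]; ring
    rw [this, abs_neg, abs_mul, abs_of_pos (hU y)]
    exact mul_le_mul_of_nonneg_right (hSx y hy) (abs_nonneg _)
  -- The derivative of G is a sum of nonnegative terms, while G tends to 0 at both ends because V -
  -- U does and W/U is bounded. Hence G is constantly 0 and each term of its derivative vanishes.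
  set G : ℝ → ℝ := fun x => (V x - U x) * (wronskian U V x / U x) with hG
  have hGd : ∀ x, HasDerivAt G ((wronskian U V x / U x) ^ 2 +
      V x * (V x + U x) * (V x - U x) ^ 2 / ε ^ 2) x := fun x => by
    have hUx := (hU x).ne'
    refine (((h.snd.hasDerivAt x).fun_sub (h.fst.hasDerivAt x)).fun_mul
      ((h.hasDerivAt_wronskian hε x).fun_div (h.fst.hasDerivAt x) hUx)).congr_deriv ?_
    unfold wronskian
    field_simp
    ring
  have hGmono : Monotone G := by
    refine monotone_of_deriv_nonneg (fun x => (hGd x).differentiableAt) fun x => ?_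
    rw [(hGd x).deriv]
    have := hU x
    have := hV x
    positivity
  have hGle : ∀ x, 1 ≤ |x| → |G x| ≤ |V x - U x| * ∫ y, |H y| := by
    intro x hx
    have hw : |wronskian U V x| ≤ U x * ∫ y, |H y| := by
      rcases le_abs'.1 hx with h1 | h1
      · refine (abs_le_integral_Iic (h.hasDerivAt_wronskian hε) h.integrable_wronskian hF x).trans
          (htail x _ measurableSet_Iic fun y hy => ?_)
        exact hmono (Set.mem_Iic.2 (le_trans hy h1)) (Set.mem_Iic.2 h1) hy
      · refine (abs_le_integral_Ioi (h.hasDerivAt_wronskian hε) h.integrable_wronskian hF x).trans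
          (htail x _ measurableSet_Ioi fun y hy => ?_)
        exact hanti (Set.mem_Ici.2 h1) (Set.mem_Ici.2 (h1.trans (le_of_lt hy))) (le_of_lt hy)
    rw [hG, abs_mul, abs_div, abs_of_pos (hU x)]
    refine mul_le_mul_of_nonneg_left ?_ (abs_nonneg _)
    rwa [div_le_iff₀ (hU x), mul_comm]
  have hzero : ∀ x, G x = 0 := by
    have hd := h.snd.sub h.fst
    refine fun x => le_antisymm (hGmono.ge_of_tendsto ?_ x) (hGmono.le_of_tendsto ?_ x)
    · have hl : Tendsto (fun x => |V x - U x| * ∫ y, |H y|) atTop (𝓝 0) := by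
        simpa using hd.tendsto_atTop.abs.mul_const (∫ y, |H y|)
      exact squeeze_zero_norm' ((eventually_ge_atTop 1).mono fun x hx =>
        hGle x (hx.trans (le_abs_self x))) hl
    · have hl : Tendsto (fun x => |V x - U x| * ∫ y, |H y|) atBot (𝓝 0) := by
        simpa using hd.tendsto_atBot.abs.mul_const (∫ y, |H y|)
      exact squeeze_zero_norm' ((eventually_le_atBot (-1)).mono fun x hx =>
        hGle x (le_abs'.2 (Or.inl hx))) hl
  ext x
  have h0 : (wronskian U V x / U x) ^ 2 + V x * (V x + U x) * (V x - U x) ^ 2 / ε ^ 2 = 0 := by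
    rw [← (hGd x).deriv, show G = fun _ => 0 from funext hzero]
    simp
  have hUx := hU x
  have hVx := hV x
  have h1 : V x * (V x + U x) * (V x - U x) ^ 2 / ε ^ 2 = 0 :=
    le_antisymm (by linarith [sq_nonneg (wronskian U V x / U x)]) (by positivity)
  have hne : V x * (V x + U x) ≠ 0 := by positivity
  rw [div_eq_zero_iff, or_iff_left (by positivity), mul_eq_zero, or_iff_right hne,
    pow_eq_zero_iff two_ne_zero] at h1
  linarith

end CoupledSolution

/-! ### Steady states and ground states -/

variable {ε γ : ℝ} {η u v : ℝ → ℝ} {Ψ Φ : (ℝ → ℝ) × (ℝ → ℝ)}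

theorem IsSteadyState.coupledSolution (h : IsSteadyState ε γ Ψ) :
    CoupledSolution ε 1 γ Ψ.1 Ψ.2 where
  fst := ⟨h.contDiff_fst, h.memEnergy_fst⟩
  snd := ⟨h.contDiff_snd, h.memEnergy_snd⟩
  eqn_fst x := by linear_combination -h.eqn_fst x
  eqn_snd x := by linear_combination -h.eqn_snd x

theorem CoupledSolution.isSteadyState (h : CoupledSolution ε 1 γ u v) :
    IsSteadyState ε γ (u, v) where
  contDiff_fst := h.fst.contDiff
  contDiff_snd := h.snd.contDiff
  memEnergy_fst := h.fst.memEnergy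
  memEnergy_snd := h.snd.memEnergy
  eqn_fst x := by linear_combination -h.eqn_fst x
  eqn_snd x := by linear_combination -h.eqn_snd x

/-- Up to scale this is a rotation by π/4 in the target plane. It sends states with equal components
to states with zero second component, and the new coupling difference is (1 - γ)/2. -/
theorem CoupledSolution.add_sub (h : CoupledSolution ε 1 γ u v) :
    CoupledSolution ε ((1 + γ) / 4) ((3 - γ) / 4) (u + v) (u - v) where
  fst := h.fst.add h.snd
  snd := h.fst.sub h.snd
  eqn_fst x := by
    rw [h.deriv_deriv_add]
    simp only [Pi.add_apply, Pi.sub_apply]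
    ring
  eqn_snd x := by
    have := h.neg_snd.deriv_deriv_add x
    rw [show u - v = u + fun x => -1 * v x by ext x; simp [sub_eq_add_neg], this]
    simp only [Pi.add_apply]
    ring

theorem IsRegular.deriv_deriv_const_mul (hu : IsRegular u) (c x : ℝ) :
    deriv (deriv fun x => c * u x) x = c * deriv (deriv u) x := by
  have : (deriv fun x => c * u x) = fun x => c * deriv u x := by
    ext x; exact deriv_const_mul _ (hu.differentiable x)
  rw [this, deriv_const_mul _ (hu.contDiff.differentiable_deriv_two x)]

namespace IsGroundState

theorem isRegular (h : IsGroundState ε η) : IsRegular η := ⟨h.contDiff, h.memEnergy⟩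

/-- Each amplitude either vanishes, making its equation trivial, or sees total cubic coefficient 1,
reducing it to the scalar equation. -/
theorem const_mul_coupledSolution (h : IsGroundState ε η) (γ c d : ℝ)
    (hc : c = 0 ∨ c ^ 2 + γ * d ^ 2 = 1) (hd : d = 0 ∨ γ * c ^ 2 + d ^ 2 = 1) :
    CoupledSolution ε 1 γ (fun x => c * η x) (fun x => d * η x) where
  fst := h.isRegular.const_mul c
  snd := h.isRegular.const_mul d
  eqn_fst x := by
    rw [h.isRegular.deriv_deriv_const_mul]
    rcases hc with rfl | hc
    · simp
    · linear_combination c * h.eqn x - c * η x ^ 3 * hc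
  eqn_snd x := by
    rw [h.isRegular.deriv_deriv_const_mul]
    rcases hd with rfl | hd
    · simp
    · linear_combination d * h.eqn x - d * η x ^ 3 * hd

/-- Cross-coupling 0 treats two scalar solutions as one uncoupled system, so that `eq_of_pos`
applies. -/
theorem unique (h : IsGroundState ε η) (hε : 0 < ε) (hu : IsRegular u) (hpos : ∀ x, 0 < u x)
    (hode : ∀ x, ε ^ 2 * deriv (deriv u) x = (x ^ 2 - 1 + u x ^ 2) * u x) : u = η := by
  have : CoupledSolution ε 1 0 u η :=
    ⟨hu, h.isRegular, fun x => by rw [hode]; ring, fun x => by linear_combination h.eqn x⟩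
  exact this.eq_of_pos hε hpos h.pos

theorem exists_lower_bound (h : IsGroundState ε η) :
    ∃ m, 0 < m ∧ ∀ x ∈ Set.Icc (-1 : ℝ) 1, m ≤ η x := by
  obtain ⟨z, -, hz⟩ := (isCompact_Icc (a := (-1 : ℝ)) (b := 1)).exists_isMinOn
    ⟨0, by norm_num⟩ h.isRegular.continuous.continuousOn
  exact ⟨η z, h.pos z, fun x hx => hz hx⟩

end IsGroundState

/-! ### The energy distance -/

/-- Pairs of functions of class `C²` in the energy space. -/
def IsRegularPair (Ψ : (ℝ → ℝ) × (ℝ → ℝ)) : Prop := IsRegular Ψ.1 ∧ IsRegular Ψ.2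

theorem IsSteadyState.isRegularPair (h : IsSteadyState ε γ Ψ) : IsRegularPair Ψ :=
  ⟨h.coupledSolution.fst, h.coupledSolution.snd⟩

theorem IsGroundState.isRegularPair_rotatingState (h : IsGroundState ε η) (θ : ℝ) :
    IsRegularPair (rotatingState θ η) :=
  ⟨h.isRegular.const_mul _, h.isRegular.const_mul _⟩

theorem energyDist_eq (Ψ Φ : (ℝ → ℝ) × (ℝ → ℝ)) :
    energyDist Ψ Φ = √(energySq (Ψ.1 - Φ.1) + energySq (Ψ.2 - Φ.2)) := rfl

theorem energyDist_nonneg (Ψ Φ : (ℝ → ℝ) × (ℝ → ℝ)) : 0 ≤ energyDist Ψ Φ := Real.sqrt_nonneg _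

theorem energyDist_sq (Ψ Φ : (ℝ → ℝ) × (ℝ → ℝ)) :
    energyDist Ψ Φ ^ 2 = energySq (Ψ.1 - Φ.1) + energySq (Ψ.2 - Φ.2) := by
  rw [energyDist_eq, Real.sq_sqrt (add_nonneg (energySq_nonneg _) (energySq_nonneg _))]

theorem energyDist_swap (Ψ Φ : (ℝ → ℝ) × (ℝ → ℝ)) :
    energyDist Ψ.swap Φ.swap = energyDist Ψ Φ := by
  rw [energyDist_eq, energyDist_eq, add_comm]
  rfl

theorem IsRegularPair.abs_fst_sub_le (hΨ : IsRegularPair Ψ) (hΦ : IsRegularPair Φ) (x : ℝ) :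
    |Ψ.1 x - Φ.1 x| ≤ energyDist Ψ Φ := by
  refine ((hΨ.1.sub hΦ.1).abs_le x).trans (Real.sqrt_le_sqrt ?_)
  exact le_add_of_nonneg_right (energySq_nonneg _)

theorem IsRegularPair.abs_snd_sub_le (hΨ : IsRegularPair Ψ) (hΦ : IsRegularPair Φ) (x : ℝ) :
    |Ψ.2 x - Φ.2 x| ≤ energyDist Ψ Φ := by
  refine ((hΨ.2.sub hΦ.2).abs_le x).trans (Real.sqrt_le_sqrt ?_)
  exact le_add_of_nonneg_left (energySq_nonneg _)

theorem IsRegularPair.energyDist_sq_le {Ω : (ℝ → ℝ) × (ℝ → ℝ)} (hΨ : IsRegularPair Ψ)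
    (hΦ : IsRegularPair Φ) (hΩ : IsRegularPair Ω) :
    energyDist Ψ Ω ^ 2 ≤ 2 * energyDist Ψ Φ ^ 2 + 2 * energyDist Φ Ω ^ 2 := by
  rw [energyDist_sq, energyDist_sq, energyDist_sq]
  have h1 := (hΨ.1.sub hΦ.1).energySq_add_le (hΦ.1.sub hΩ.1)
  have h2 := (hΨ.2.sub hΦ.2).energySq_add_le (hΦ.2.sub hΩ.2)
  rw [sub_add_sub_cancel] at h1 h2
  linarith

theorem IsRegularPair.energySq_le (hΨ : IsRegularPair Ψ) (hΦ : IsRegularPair Φ) :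
    energySq Ψ.1 + energySq Ψ.2 ≤
      2 * (energySq Φ.1 + energySq Φ.2) + 2 * energyDist Ψ Φ ^ 2 := by
  have h1 := hΦ.1.energySq_add_le (hΨ.1.sub hΦ.1)
  have h2 := hΦ.2.energySq_add_le (hΨ.2.sub hΦ.2)
  rw [add_sub_cancel] at h1 h2
  rw [energyDist_sq]
  linarith

theorem IsRegular.energySq_const_mul_sub (hη : IsRegular η) (c d : ℝ) :
    energySq ((fun x => c * η x) - fun x => d * η x) = (c - d) ^ 2 * energySq η := by
  rw [← hη.energySq_const_mul]
  congr 1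
  ext x
  simp only [Pi.sub_apply]
  ring

theorem IsGroundState.energySq_rotatingState (h : IsGroundState ε η) (θ : ℝ) :
    energySq (rotatingState θ η).1 + energySq (rotatingState θ η).2 = energySq η := by
  simp only [rotatingState]
  rw [h.isRegular.energySq_const_mul, h.isRegular.energySq_const_mul, ← add_mul,
    Real.cos_sq_add_sin_sq, one_mul]

theorem tendsto_energyDist_const_mul {ι : Type*} {l : Filter ι} (hη : IsRegular η)
    {c d : ι → ℝ} {c₀ d₀ : ℝ} (hc : Tendsto c l (𝓝 c₀)) (hd : Tendsto d l (𝓝 d₀)) :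
    Tendsto (fun i => energyDist (fun x => c i * η x, fun x => d i * η x)
      (fun x => c₀ * η x, fun x => d₀ * η x)) l (𝓝 0) := by
  simp only [energyDist_eq, hη.energySq_const_mul_sub]
  have h : Tendsto (fun i => √((c i - c₀) ^ 2 * energySq η + (d i - d₀) ^ 2 * energySq η)) l
      (𝓝 √((c₀ - c₀) ^ 2 * energySq η + (d₀ - d₀) ^ 2 * energySq η)) :=
    ((((hc.sub_const c₀).pow 2).mul_const _).add (((hd.sub_const d₀).pow 2).mul_const _)).sqrt
  simpa using h

theorem rotatingState_zero (η : ℝ → ℝ) : rotatingState 0 η = uncoupledFst η := by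
  simp [rotatingState, uncoupledFst]

theorem rotatingState_pi_div_two (η : ℝ → ℝ) :
    rotatingState (Real.pi / 2) η = uncoupledSnd η := by
  simp [rotatingState, uncoupledSnd]

theorem rotatingState_swap (θ : ℝ) (η : ℝ → ℝ) :
    (rotatingState θ η).swap = rotatingState (Real.pi / 2 - θ) η := by
  simp [rotatingState, Real.cos_pi_div_two_sub, Real.sin_pi_div_two_sub]

theorem energyDist_self (Ψ : (ℝ → ℝ) × (ℝ → ℝ)) : energyDist Ψ Ψ = 0 := by
  simp [energyDist]

/-! ### Steady states close to a member of the family -/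

/-- Chooses how close γ must be to 1 for the contraction factor to be below 1; the cap δ ≤ 1 also
keeps γ positive. -/
theorem exists_pos_forall_lt (hε : 0 < ε) {K : ℝ} (hK : 0 ≤ K) :
    ∃ δ : ℝ, 0 < δ ∧ δ ≤ 1 ∧ ∀ t, t < δ → t / ε ^ 2 * K * Real.pi < 1 := by
  have hπ := Real.pi_pos
  have hpos : 0 < K * Real.pi + 1 := by positivity
  refine ⟨min 1 (ε ^ 2 / (K * Real.pi + 1)), by positivity, min_le_left _ _, fun t ht => ?_⟩
  have h1 := ht.trans_le (min_le_right _ _)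
  rw [lt_div_iff₀ hpos] at h1
  have hε2 : 0 < ε ^ 2 := by positivity
  rcases le_total t 0 with h0 | h0
  · have : t / ε ^ 2 * K * Real.pi ≤ 0 := by
      rw [mul_assoc]
      exact mul_nonpos_of_nonpos_of_nonneg (div_nonpos_of_nonpos_of_nonneg h0 hε2.le)
        (by positivity)
    linarith
  · rw [div_mul_eq_mul_div, div_mul_eq_mul_div, div_lt_one hε2]
    nlinarith

namespace IsGroundState

theorem exists_near_zero (h : IsGroundState ε η) (hε : 0 < ε) :
    ∃ r, 0 < r ∧ ∃ δ, 0 < δ ∧ ∀ γ, γ ≠ 1 → |γ - 1| < δ → ∀ Ψ, IsSteadyState ε γ Ψ →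
      energyDist Ψ (rotatingState 0 η) < r → Ψ = uncoupledFst η := by
  obtain ⟨m, hm, hmη⟩ := h.exists_lower_bound
  -- The energy bound for states within m/4 of the family. The same radius leaves ψ₁ ≥ m/2 > |ψ₂| on
  -- [-1, 1].
  set N := 2 * energySq η + 2 * (m / 4) ^ 2 with hNdef
  have hN0 : 0 ≤ N := by have := energySq_nonneg η; positivity
  obtain ⟨δ, hδ, hδ1, hsmall⟩ :=
    exists_pos_forall_lt hε (by positivity : 0 ≤ N + 2 * N ^ 2 / (m / 2) ^ 2)
  refine ⟨m / 4, by positivity, δ, hδ, fun γ hγ hγδ Ψ hΨ hd => ?_⟩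
  have hc := hΨ.coupledSolution
  obtain ⟨hγ0, hγ1⟩ := abs_lt.1 (hγδ.trans_le hδ1)
  have hreg := hΨ.isRegularPair
  have hreg0 := h.isRegularPair_rotatingState 0
  have h1 : ∀ x, |Ψ.1 x - η x| < m / 4 := fun x => by
    simpa [rotatingState] using (hreg.abs_fst_sub_le hreg0 x).trans_lt hd
  have h2 : ∀ x, |Ψ.2 x| < m / 4 := fun x => by
    simpa [rotatingState] using (hreg.abs_snd_sub_le hreg0 x).trans_lt hd
  have hU : ∀ x ∈ Set.Icc (-1 : ℝ) 1, m / 2 ≤ Ψ.1 x := fun x hx => by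
    linarith [hmη x hx, (abs_lt.1 (h1 x)).1]
  have hE : energySq Ψ.1 ≤ N := by
    have := hreg.energySq_le hreg0
    rw [h.energySq_rotatingState] at this
    have : energyDist Ψ (rotatingState 0 η) ^ 2 ≤ (m / 4) ^ 2 :=
      pow_le_pow_left₀ (energyDist_nonneg _ _) hd.le 2
    linarith [energySq_nonneg Ψ.2]
  have hV := hc.snd_eq_zero hε hγ.symm zero_le_one (by linarith)
    (by linarith : |γ - 1| ≤ 2 * 1) (half_pos hm) hU
    (fun x hx => by linarith [hU x hx, h2 x]) hE (hsmall _ hγδ)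
  have hpos := (hc.pos_fst hε zero_le_one (by linarith) fun x hx =>
    (half_pos hm).trans_le (hU x hx)).1
  refine Prod.ext (h.unique hε hc.fst hpos fun x => ?_) (funext hV)
  rw [hc.eqn_fst, hV]
  ring

theorem exists_near_pi_div_four (h : IsGroundState ε η) (hε : 0 < ε) :
    ∃ r, 0 < r ∧ ∃ δ, 0 < δ ∧ ∀ γ, γ ≠ 1 → |γ - 1| < δ → ∀ Ψ, IsSteadyState ε γ Ψ →
      energyDist Ψ (rotatingState (Real.pi / 4) η) < r → Ψ = symmetricState γ η := by
  obtain ⟨m, hm, hmη⟩ := h.exists_lower_bound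
  -- The outer factor 2 is the cost of passing to the energy of the sum. Within radius m/8 the sum
  -- is at least m/2 on [-1, 1], and the difference is below m/4.
  set N := 2 * (2 * energySq η + 2 * (m / 8) ^ 2) with hNdef
  have hN0 : 0 ≤ N := by have := energySq_nonneg η; positivity
  obtain ⟨δ, hδ, hδ1, hsmall⟩ :=
    exists_pos_forall_lt hε (by positivity : 0 ≤ N + 2 * N ^ 2 / (m / 2) ^ 2)
  refine ⟨m / 8, by positivity, δ, hδ, fun γ hγ hγδ Ψ hΨ hd => ?_⟩
  have hc := hΨ.coupledSolution.add_sub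
  obtain ⟨hγ0, hγ1⟩ := abs_lt.1 (hγδ.trans_le hδ1)
  have hreg := hΨ.isRegularPair
  have hreg0 := h.isRegularPair_rotatingState (Real.pi / 4)
  have hcs : 1 / 2 ≤ √2 / 2 := by
    have : (1 : ℝ) ≤ √2 := Real.one_le_sqrt.2 one_le_two
    linarith
  have h1 : ∀ x, |Ψ.1 x - √2 / 2 * η x| < m / 8 := fun x => by
    simpa [rotatingState] using (hreg.abs_fst_sub_le hreg0 x).trans_lt hd
  have h2 : ∀ x, |Ψ.2 x - √2 / 2 * η x| < m / 8 := fun x => by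
    simpa [rotatingState] using (hreg.abs_snd_sub_le hreg0 x).trans_lt hd
  have hU : ∀ x ∈ Set.Icc (-1 : ℝ) 1, m / 2 ≤ (Ψ.1 + Ψ.2) x := fun x hx => by
    have : 1 / 2 * m ≤ √2 / 2 * η x := by
      have := hmη x hx
      gcongr
    have := abs_lt.1 (h1 x)
    have := abs_lt.1 (h2 x)
    simp only [Pi.add_apply]
    linarith
  have hE : energySq (Ψ.1 + Ψ.2) ≤ N := by
    have := hreg.energySq_le hreg0
    rw [h.energySq_rotatingState] at this
    have : energyDist Ψ (rotatingState (Real.pi / 4) η) ^ 2 ≤ (m / 8) ^ 2 :=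
      pow_le_pow_left₀ (energyDist_nonneg _ _) hd.le 2
    linarith [hreg.1.energySq_add_le hreg.2]
  have hba : |(3 - γ) / 4 - (1 + γ) / 4| = |γ - 1| / 2 := by
    rw [show (3 - γ) / 4 - (1 + γ) / 4 = -((γ - 1) / 2) by ring, abs_neg, abs_div, abs_two]
  have hV := hc.snd_eq_zero hε (fun he => hγ (by linarith)) (by linarith) (by linarith)
    (by rw [hba]; linarith [hδ1]) (half_pos hm) hU
    (fun x hx => (abs_lt.2 (by
      have := hU x hx
      have := abs_lt.1 (h1 x)
      have := abs_lt.1 (h2 x)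
      simp only [Pi.add_apply, Pi.sub_apply] at *
      constructor <;> linarith))) hE
    (hsmall _ (by rw [hba]; linarith [abs_nonneg (γ - 1)]))
  have hpos := (hc.pos_fst hε (by linarith) (by linarith) fun x hx =>
    (half_pos hm).trans_le (hU x hx)).1
  have heq : ∀ x, Ψ.2 x = Ψ.1 x := fun x => by
    have := hV x
    simp only [Pi.sub_apply] at this
    linarith
  have hs : 0 < √(1 + γ) := Real.sqrt_pos.2 (by linarith)
  have hs2 : √(1 + γ) ^ 2 = 1 + γ := Real.sq_sqrt (by linarith)
  have hu : (fun x => √(1 + γ) * Ψ.1 x) = η := by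
    refine h.unique hε (hreg.1.const_mul _) (fun x => ?_) fun x => ?_
    · have := hpos x
      simp only [Pi.add_apply, heq] at this
      exact mul_pos hs (by linarith)
    · rw [hreg.1.deriv_deriv_const_mul]
      have := hΨ.coupledSolution.eqn_fst x
      rw [heq] at this
      linear_combination √(1 + γ) * this - √(1 + γ) * Ψ.1 x ^ 3 * hs2
  have h1' : ∀ x, Ψ.1 x = (√(1 + γ))⁻¹ * η x := fun x => by
    rw [← congrFun hu x]
    field_simp
  exact Prod.ext (funext h1') (funext fun x => (heq x).trans (h1' x))

/-- Here sin θ and cos θ - sin θ are both positive, so a nearby state has 0 < ψ₂ < ψ₁ on [-1, 1],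
hence on the whole line, against `not_pos_lt`. -/
theorem not_near (h : IsGroundState ε η) (hε : 0 < ε) {θ : ℝ} (hθ0 : 0 < θ)
    (hθ : θ < Real.pi / 4) :
    ∃ r, 0 < r ∧ ∃ δ, 0 < δ ∧ ∀ γ, γ ≠ 1 → |γ - 1| < δ → ∀ Ψ, IsSteadyState ε γ Ψ →
      ¬ energyDist Ψ (rotatingState θ η) < r := by
  obtain ⟨m, hm, hmη⟩ := h.exists_lower_bound
  have hsin : 0 < Real.sin θ := Real.sin_pos_of_pos_of_lt_pi hθ0 (by linarith [Real.pi_pos])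
  have hcos : 0 < Real.cos θ - Real.sin θ := by
    rw [← Real.cos_pi_div_two_sub, sub_pos]
    exact Real.cos_lt_cos_of_nonneg_of_le_pi hθ0.le (by linarith) (by linarith)
  set k := min (Real.sin θ) (Real.cos θ - Real.sin θ) with hk
  have hk0 : 0 < k := lt_min hsin hcos
  -- Half of k m, because the difference of the components accumulates two errors.
  refine ⟨k * m / 2, by positivity, 1, one_pos, fun γ hγ hγδ Ψ hΨ hd => ?_⟩
  have hc := hΨ.coupledSolution
  obtain ⟨hγ0, hγ1⟩ := abs_lt.1 hγδ
  have hreg := hΨ.isRegularPair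
  have hreg0 := h.isRegularPair_rotatingState θ
  have h1 : ∀ x, |Ψ.1 x - Real.cos θ * η x| < k * m / 2 := fun x =>
    (hreg.abs_fst_sub_le hreg0 x).trans_lt hd
  have h2 : ∀ x, |Ψ.2 x - Real.sin θ * η x| < k * m / 2 := fun x =>
    (hreg.abs_snd_sub_le hreg0 x).trans_lt hd
  refine hc.not_pos_lt hε hγ.symm
    (hc.swap.pos_fst hε zero_le_one (by linarith) fun x hx => ?_).1
    fun x => sub_pos.1 (hc.pos_sub hε (by linarith) (fun x hx => ?_) x)
  · have : k * m ≤ Real.sin θ * η x :=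
      mul_le_mul (min_le_left _ _) (hmη x hx) hm.le hsin.le
    linarith [(abs_lt.1 (h2 x)).1, mul_pos hk0 hm]
  · have : k * m ≤ (Real.cos θ - Real.sin θ) * η x :=
      mul_le_mul (min_le_right _ _) (hmη x hx) hm.le hcos.le
    linarith [(abs_lt.1 (h2 x)).2, (abs_lt.1 (h1 x)).1]

/-- The possible continuations of the member of the family at the angle `θ`. -/
def IsListed (η : ℝ → ℝ) (θ γ : ℝ) (Ψ : (ℝ → ℝ) × (ℝ → ℝ)) : Prop :=
  (θ = 0 ∧ Ψ = uncoupledFst η) ∨ (θ = Real.pi / 4 ∧ Ψ = symmetricState γ η) ∨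
    (θ = Real.pi / 2 ∧ Ψ = uncoupledSnd η)

theorem exists_near_of_le (h : IsGroundState ε η) (hε : 0 < ε) {θ : ℝ} (hθ0 : 0 ≤ θ)
    (hθ : θ ≤ Real.pi / 4) :
    ∃ r, 0 < r ∧ ∃ δ, 0 < δ ∧ ∀ γ, γ ≠ 1 → |γ - 1| < δ → ∀ Ψ, IsSteadyState ε γ Ψ →
      energyDist Ψ (rotatingState θ η) < r → IsListed η θ γ Ψ := by
  rcases hθ0.eq_or_lt with rfl | hθ0
  · obtain ⟨r, hr, δ, hδ, H⟩ := h.exists_near_zero hε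
    exact ⟨r, hr, δ, hδ, fun γ h1 h2 Ψ h3 h4 => Or.inl ⟨rfl, H γ h1 h2 Ψ h3 h4⟩⟩
  rcases hθ.eq_or_lt with rfl | hθ
  · obtain ⟨r, hr, δ, hδ, H⟩ := h.exists_near_pi_div_four hε
    exact ⟨r, hr, δ, hδ, fun γ h1 h2 Ψ h3 h4 => Or.inr (Or.inl ⟨rfl, H γ h1 h2 Ψ h3 h4⟩)⟩
  · obtain ⟨r, hr, δ, hδ, H⟩ := h.not_near hε hθ0 hθ
    exact ⟨r, hr, δ, hδ, fun γ h1 h2 Ψ h3 h4 => absurd h4 (H γ h1 h2 Ψ h3)⟩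

theorem exists_near (h : IsGroundState ε η) (hε : 0 < ε) {θ : ℝ}
    (hθ : θ ∈ Set.Icc 0 (Real.pi / 2)) :
    ∃ r, 0 < r ∧ ∃ δ, 0 < δ ∧ ∀ γ, γ ≠ 1 → |γ - 1| < δ → ∀ Ψ, IsSteadyState ε γ Ψ →
      energyDist Ψ (rotatingState θ η) < r → IsListed η θ γ Ψ := by
  rcases le_total θ (Real.pi / 4) with h4 | h4
  · exact h.exists_near_of_le hε hθ.1 h4
  obtain ⟨r, hr, δ, hδ, H⟩ := h.exists_near_of_le hε (θ := Real.pi / 2 - θ)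
    (by linarith [hθ.2]) (by linarith)
  refine ⟨r, hr, δ, hδ, fun γ h1 h2 Ψ h3 h4 => ?_⟩
  rw [← energyDist_swap, rotatingState_swap] at h4
  rcases H γ h1 h2 _ h3.coupledSolution.swap.isSteadyState h4 with ⟨h5, h6⟩ | ⟨h5, h6⟩ | ⟨h5, h6⟩
  · exact Or.inr (Or.inr ⟨by linarith, Prod.swap_injective h6⟩)
  · exact Or.inr (Or.inl ⟨by linarith, Prod.swap_injective h6⟩)
  · exact Or.inl ⟨by linarith, Prod.swap_injective h6⟩

/-- The radii and parameter ranges of `exists_near` depend on θ; induction on the compact interval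
makes them uniform. -/
theorem exists_near_family (h : IsGroundState ε η) (hε : 0 < ε) :
    ∃ r, 0 < r ∧ ∃ δ, 0 < δ ∧ ∀ γ, γ ≠ 1 → |γ - 1| < δ → ∀ Ψ, IsSteadyState ε γ Ψ →
      (∃ θ ∈ Set.Icc 0 (Real.pi / 2), energyDist Ψ (rotatingState θ η) < r) →
      ∃ θ, IsListed η θ γ Ψ := by
  refine (isCompact_Icc (a := (0 : ℝ)) (b := Real.pi / 2)).induction_on
    (p := fun s => ∃ r, 0 < r ∧ ∃ δ, 0 < δ ∧ ∀ γ, γ ≠ 1 → |γ - 1| < δ → ∀ Ψ,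
      IsSteadyState ε γ Ψ → (∃ θ ∈ s, energyDist Ψ (rotatingState θ η) < r) →
      ∃ θ, IsListed η θ γ Ψ) ?_ ?_ ?_ ?_
  · exact ⟨1, one_pos, 1, one_pos, fun γ _ _ Ψ _ ⟨θ, hθ, _⟩ => absurd hθ (Set.notMem_empty θ)⟩
  · rintro s t hst ⟨r, hr, δ, hδ, H⟩
    exact ⟨r, hr, δ, hδ, fun γ h1 h2 Ψ h3 ⟨θ, h4, h5⟩ => H γ h1 h2 Ψ h3 ⟨θ, hst h4, h5⟩⟩
  · rintro s t ⟨r, hr, δ, hδ, H⟩ ⟨r', hr', δ', hδ', H'⟩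
    refine ⟨min r r', lt_min hr hr', min δ δ', lt_min hδ hδ', fun γ h1 h2 Ψ h3 => ?_⟩
    rintro ⟨θ, h4 | h4, h5⟩
    · exact H γ h1 (h2.trans_le (min_le_left _ _)) Ψ h3 ⟨θ, h4, h5.trans_le (min_le_left _ _)⟩
    · exact H' γ h1 (h2.trans_le (min_le_right _ _)) Ψ h3 ⟨θ, h4, h5.trans_le (min_le_right _ _)⟩
  · intro θ₀ hθ₀
    obtain ⟨r, hr, δ, hδ, H⟩ := h.exists_near hε hθ₀
    have hlim : Tendsto (fun θ => energyDist (rotatingState θ η) (rotatingState θ₀ η)) (𝓝 θ₀)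
        (𝓝 0) :=
      tendsto_energyDist_const_mul h.isRegular (Real.continuous_cos.tendsto θ₀)
        (Real.continuous_sin.tendsto θ₀)
    refine ⟨_, mem_nhdsWithin_of_mem_nhds (hlim.eventually_lt_const (half_pos hr)), r / 2,
      half_pos hr, δ, hδ, fun γ h1 h2 Ψ h3 ⟨θ, h4, h5⟩ => ⟨θ₀, H γ h1 h2 Ψ h3 ?_⟩⟩
    have h4' : energyDist (rotatingState θ η) (rotatingState θ₀ η) < r / 2 := h4
    have h6 := h3.isRegularPair.energyDist_sq_le (h.isRegularPair_rotatingState θ)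
      (h.isRegularPair_rotatingState θ₀)
    have h7 := pow_lt_pow_left₀ h4' (energyDist_nonneg _ _) two_ne_zero
    have h8 := pow_lt_pow_left₀ h5 (energyDist_nonneg _ _) two_ne_zero
    -- Half the radius is exactly enough: 2(r/2)² + 2(r/2)² = r².
    exact lt_of_pow_lt_pow_left₀ 2 hr.le (by linarith)

/-- The reflection condition at x = 0 would force η(0) = 0 for an uncoupled state; the symmetric
state has equal components. -/
theorem not_isDomainWall (h : IsGroundState ε η) {θ : ℝ} (hΨ : IsListed η θ γ Ψ) :
    ¬ IsDomainWall ε γ Ψ := by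
  rintro ⟨-, h1, h2⟩
  rcases hΨ with ⟨-, rfl⟩ | ⟨-, rfl⟩ | ⟨-, rfl⟩
  · exact (h.pos 0).ne' (h1 0)
  · exact h2 rfl
  · exact (h.pos (-0)).ne (h1 0)

end IsGroundState

end GrossPitaevskii

end

/-! ### The main theorem -/

theorem theorem1p5 :
    ∃ ε₀ : ℝ, 0 < ε₀ ∧ ∀ ε : ℝ, 0 < ε → ε < ε₀ →
      ∀ η : ℝ → ℝ, GrossPitaevskii.IsGroundState ε η →
        -- the one-parameter family consists of solutions at `γ = 1`
        (∀ θ ∈ Set.Icc 0 (Real.pi / 2),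
          GrossPitaevskii.IsSteadyState ε 1 (GrossPitaevskii.rotatingState θ η)) ∧
        -- the uncoupled and symmetric states continue the members at `0`, `π/4`, `π/2`
        GrossPitaevskii.IsContinuation ε (Set.Ioi 0 \ {1})
          (GrossPitaevskii.rotatingState 0 η)
          (fun _ => GrossPitaevskii.uncoupledFst η) ∧
        GrossPitaevskii.IsContinuation ε (Set.Ioi 0 \ {1})
          (GrossPitaevskii.rotatingState (Real.pi / 4) η)
          (fun γ => GrossPitaevskii.symmetricState γ η) ∧
        GrossPitaevskii.IsContinuation ε (Set.Ioi 0 \ {1})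
          (GrossPitaevskii.rotatingState (Real.pi / 2) η)
          (fun _ => GrossPitaevskii.uncoupledSnd η) ∧
        -- there are no other continuations, along any set of parameters accumulating at `1`
        (∀ θ ∈ Set.Icc 0 (Real.pi / 2), ∀ A : Set ℝ, A ⊆ Set.Ioi 0 \ {1} → 1 ∈ closure A →
          ∀ Ψ : ℝ → (ℝ → ℝ) × (ℝ → ℝ),
            GrossPitaevskii.IsContinuation ε A (GrossPitaevskii.rotatingState θ η) Ψ →
              (θ = 0 ∧ ∀ᶠ γ in 𝓝[A] 1, Ψ γ = GrossPitaevskii.uncoupledFst η) ∨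
              (θ = Real.pi / 4 ∧ ∀ᶠ γ in 𝓝[A] 1, Ψ γ = GrossPitaevskii.symmetricState γ η) ∨
              (θ = Real.pi / 2 ∧ ∀ᶠ γ in 𝓝[A] 1, Ψ γ = GrossPitaevskii.uncoupledSnd η)) ∧
        -- solutions near the family for `γ ≠ 1` near `1`; none of them is a domain wall
        ∃ r : ℝ, 0 < r ∧ ∃ δ₀ : ℝ, 0 < δ₀ ∧ ∀ γ : ℝ, 0 < γ → γ ≠ 1 → |γ - 1| < δ₀ →
          ∀ Ψ : (ℝ → ℝ) × (ℝ → ℝ), GrossPitaevskii.IsSteadyState ε γ Ψ →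
            (∃ θ ∈ Set.Icc 0 (Real.pi / 2),
              GrossPitaevskii.energyDist Ψ (GrossPitaevskii.rotatingState θ η) < r) →
            (Ψ = GrossPitaevskii.uncoupledFst η ∨ Ψ = GrossPitaevskii.uncoupledSnd η ∨
              Ψ = GrossPitaevskii.symmetricState γ η) ∧
            ¬ GrossPitaevskii.IsDomainWall ε γ Ψ := by
  -- The value 1 is arbitrary: the argument works for every ε > 0.
  refine ⟨1, one_pos, fun ε hε _ η hη => ⟨fun θ _ => ?_, ⟨fun γ _ => ?_, ?_⟩, ⟨fun γ hγ => ?_, ?_⟩,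
    ⟨fun γ _ => ?_, ?_⟩, ?_, ?_⟩⟩
  · exact (hη.const_mul_coupledSolution 1 (Real.cos θ) (Real.sin θ)
      (Or.inr (by rw [one_mul, Real.cos_sq_add_sin_sq]))
      (Or.inr (by rw [one_mul, Real.cos_sq_add_sin_sq]))).isSteadyState
  · simpa [GrossPitaevskii.uncoupledFst] using
      (hη.const_mul_coupledSolution γ 1 0 (by simp) (by simp)).isSteadyState
  · simp only [GrossPitaevskii.rotatingState_zero, GrossPitaevskii.energyDist_self,
      tendsto_const_nhds]
  · have hγ0 : 0 < γ := hγ.1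
    have hs : (√(1 + γ))⁻¹ ^ 2 = (1 + γ)⁻¹ := by
      rw [inv_pow, Real.sq_sqrt (by linarith)]
    exact (hη.const_mul_coupledSolution γ (√(1 + γ))⁻¹ (√(1 + γ))⁻¹
      (Or.inr (by rw [hs]; field_simp))
      (Or.inr (by rw [hs]; field_simp; ring))).isSteadyState
  · have hlim : Tendsto (fun γ : ℝ => (√(1 + γ))⁻¹) (𝓝[Set.Ioi 0 \ {1}] 1) (𝓝 (√2 / 2)) := by
      have h2 : (√(1 + 1))⁻¹ = √2 / 2 := by
        rw [one_add_one_eq_two, inv_eq_one_div, div_eq_div_iff (by positivity) two_ne_zero,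
          Real.mul_self_sqrt zero_le_two, one_mul]
      rw [← h2]
      refine Tendsto.mono_left (Tendsto.inv₀ ?_ (by positivity)) nhdsWithin_le_nhds
      exact (continuous_const.add continuous_id).sqrt.tendsto 1
    have := GrossPitaevskii.tendsto_energyDist_const_mul hη.isRegular hlim hlim
    simpa only [GrossPitaevskii.rotatingState, GrossPitaevskii.symmetricState, Real.cos_pi_div_four,
      Real.sin_pi_div_four] using this
  · simpa [GrossPitaevskii.uncoupledSnd] using
      (hη.const_mul_coupledSolution γ 0 1 (by simp) (by simp)).isSteadyState
  · simp only [GrossPitaevskii.rotatingState_pi_div_two, GrossPitaevskii.energyDist_self,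
      tendsto_const_nhds]
  · intro θ hθ A hA hcl Ψ hΨ
    obtain ⟨r, hr, δ, hδ, H⟩ := hη.exists_near hε hθ
    have := mem_closure_iff_nhdsWithin_neBot.1 hcl
    have hev : ∀ᶠ γ in 𝓝[A] 1, GrossPitaevskii.IsGroundState.IsListed η θ γ (Ψ γ) := by
      filter_upwards [hΨ.2.eventually_lt_const hr, self_mem_nhdsWithin,
        mem_nhdsWithin_of_mem_nhds (Metric.ball_mem_nhds (1 : ℝ) hδ)] with γ h1 h2 h3
      exact H γ (hA h2).2 h3 (Ψ γ) (hΨ.1 γ h2) h1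
    have hπ := Real.pi_pos
    -- Since 1 is in the closure of A, some γ in A realises one of the alternatives. This fixes θ,
    -- which then excludes the other two for all γ near 1.
    obtain ⟨_, ⟨h0, -⟩ | ⟨h0, -⟩ | ⟨h0, -⟩⟩ := hev.exists
    · refine Or.inl ⟨h0, hev.mono fun γ h => ?_⟩
      rcases h with h | h | h
      · exact h.2
      · linarith [h.1]
      · linarith [h.1]
    · refine Or.inr (Or.inl ⟨h0, hev.mono fun γ h => ?_⟩)
      rcases h with h | h | h
      · linarith [h.1]
      · exact h.2
      · linarith [h.1]
    · refine Or.inr (Or.inr ⟨h0, hev.mono fun γ h => ?_⟩)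
      rcases h with h | h | h
      · linarith [h.1]
      · linarith [h.1]
      · exact h.2
  · obtain ⟨r, hr, δ, hδ, H⟩ := hη.exists_near_family hε
    refine ⟨r, hr, δ, hδ, fun γ _ h1 h2 Ψ h3 h4 => ?_⟩
    obtain ⟨θ, hl⟩ := H γ h1 h2 Ψ h3 h4
    refine ⟨?_, hη.not_isDomainWall hl⟩
    rcases hl with h | h | h
    · exact Or.inl h.2
    · exact Or.inr (Or.inr h.2)
    · exact Or.inr (Or.inl h.2)
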